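/- Let $d\ge 2$, let $A$ be a real $d\times d$ matrix, and let $\lambda_1\ge\dots\ge\lambda_d\ge 0$ be the eigenvalues of $\Sigma=AA^\top$. Assume that the largest eigenvalue is $\lambda_1=1$ and let $m=\#\{j:\lambda_j=\lambda_1\}$ be its multiplicity. Let $U$ be uniformly distributed on the unit sphere of $\mathbb{R}^d$, and let $R$ be a random variable independent of $U$ with $R>0$ almost surely whose tail satisfies $$P(R>u)\sim c\,u^{N}\exp(-\delta u^{\tau}),\qquad u\to\infty,$$ with constants $c,\delta,\tau\in(0,\infty)$ and $N\in\mathbb{R}$ (a Kotz Type III radius). Assume $\delta\tau=1$. Let $X^{(1)},X^{(2)},\dots$ be independent random vectors in $\mathbb{R}^d$, each with the same distribution as $R\,A\,U$. For $s\in\mathbb{R}$ put $b_n^*=[\tau(\ln n+s\ln\ln n)]^{1/\tau}$, which is defined for all sufficiently large $n$. Then, with $\|\cdot\|$ the Euclidean norm, $$P\Bigl(\max_{1\le j\le n}\|X^{(j)}\|\ge b_n^*\ \text{ for infinitely many } n\Bigr)=\begin{cases}1 & \text{if } s\le \frac{m-d}{2}+\frac{N}{\tau}+1,\\[2pt] 0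 & \text{if } s> \frac{m-d}{2}+\frac{N}{\tau}+1.\end{cases}$$ -/

import Mathlib

open MeasureTheory ProbabilityTheory Filter Asymptotics
open scoped Topology Matrix

/-- The matrix `Σ = A Aᵀ` is symmetric. -/
theorem isHermitian_mul_transpose {d : ℕ} (A : Matrix (Fin d) (Fin d) ℝ) :
    (A * Aᵀ).IsHermitian := by
  simpa using Matrix.isHermitian_mul_conjTranspose_self A

/-- The eigenvalues of `Σ = A Aᵀ`, listed with multiplicity. -/
noncomputable def sigmaEigenvalues {d : ℕ} (A : Matrix (Fin d) (Fin d) ℝ) : Fin d → ℝ :=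
  (isHermitian_mul_transpose A).eigenvalues

/-- The largest eigenvalue of `Σ = A Aᵀ`. -/
noncomputable def topEigenvalue {d : ℕ} (A : Matrix (Fin d) (Fin d) ℝ) : ℝ :=
  ⨆ i, sigmaEigenvalues A i

/-- The multiplicity `m` of the largest eigenvalue of `Σ = A Aᵀ`. -/
noncomputable def topMultiplicity {d : ℕ} (A : Matrix (Fin d) (Fin d) ℝ) : ℕ :=
  Nat.card {i : Fin d // sigmaEigenvalues A i = topEigenvalue A}

/-- The uniform distribution on the unit sphere of `ℝ^d`: the surface measure divided by its total
mass, regarded as a measure on `ℝ^d`. -/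
noncomputable def uniformSphere (d : ℕ) : Measure (EuclideanSpace ℝ (Fin d)) :=
  let σ := (volume : Measure (EuclideanSpace ℝ (Fin d))).toSphere
  Measure.map Subtype.val ((σ Set.univ)⁻¹ • σ)

/-- The law of the elliptical random vector `R A U`, where the radius `R` has law `ν`, the vector
`U` is uniformly distributed on the unit sphere, and `R`, `U` are independent. -/
noncomputable def ellipticalLaw {d : ℕ} (A : Matrix (Fin d) (Fin d) ℝ) (ν : Measure ℝ) :
    Measure (EuclideanSpace ℝ (Fin d)) :=
  Measure.map (fun p : ℝ × EuclideanSpace ℝ (Fin d) => p.1 • Matrix.toEuclideanLin A p.2)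
    (ν.prod (uniformSphere d))

/-- The law `ν` is that of an almost surely positive random radius `R` (that is, `F(0) = 0`) with
the Kotz Type III tail `P(R > u) ~ c u^N exp(-δ u^τ)` as `u → ∞`. -/
structure IsKotzIIIRadius (ν : Measure ℝ) (c N δ τ : ℝ) : Prop where
  isProbabilityMeasure : IsProbabilityMeasure ν
  pos : ν (Set.Iic 0) = 0
  tail : (fun u : ℝ => ν.real (Set.Ioi u)) ~[atTop]
    (fun u : ℝ => c * u ^ N * Real.exp (-δ * u ^ τ))

/-- The level `b_n^* = [τ (ln n + s ln ln n)]^{1/τ}`. -/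
noncomputable def bStar (τ s : ℝ) (n : ℕ) : ℝ :=
  (τ * (Real.log n + s * Real.log (Real.log n))) ^ (1 / τ)

/-- The largest norm among the first `n` terms `X 0, …, X (n - 1)` of a sequence of vectors. -/
noncomputable def maxNorm {E : Type*} [Norm E] (X : ℕ → E) (n : ℕ) : ℝ :=
  ⨆ j : Fin n, ‖X j‖

/-! Since `U` is a unit vector, `‖AU‖²` falls short of 1 by `q = ∑ (1 - λ_i) U_i²` in
eigencoordinates. Reaching the level `t^(1/τ)` then forces `R^τ` above roughly `t (1 + τq/2)`, which
multiplies the radial tail `t^(N/τ) e^(-δt)` by a Gaussian factor in the `d - m` directions where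
`λ_i < 1`. Averaging over `U`, each of these directions costs `t^(-1/2)`, so `P(‖RAU‖ ≥ t^(1/τ))`
has exact order `t^p e^(-δt)` with `p = N/τ - (d-m)/2` (`exists_ellipticalLaw_tail_le`,
`exists_le_ellipticalLaw_tail`).

At `t = τ(ln n + s ln ln n)` with `δτ = 1` this order is `n⁻¹ (ln n)^(p-s)`
(`ellipticalLaw_tail_bStar_isTheta`), which is summable exactly when `s > p + 1`. Only the order
matters for summability, so no sharp constant is needed. As the levels eventually increase to
infinity, the maximum reaches them infinitely often iff single terms do
(`frequently_le_maxNorm_iff`), and both Borel–Cantelli lemmas conclude. -/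

/-! ### The uniform law on the sphere and eigencoordinates. -/

open scoped Pointwise in
theorem preimage_ball_normalize {E : Type*} [NormedAddCommGroup E] [NormedSpace ℝ E] (S : Set E) :
    (fun x : E => ‖x‖⁻¹ • x) ⁻¹' S ∩ (Metric.ball 0 1 \ {0}) =
      Set.Ioo (0 : ℝ) 1 • (Subtype.val '' ((Subtype.val : Metric.sphere (0 : E) 1 → E) ⁻¹' S)) := by
  ext x
  simp only [Set.mem_inter_iff, Set.mem_preimage, Set.mem_sdiff, Metric.mem_ball, dist_zero_right,
    Set.mem_singleton_iff, Set.mem_smul, Set.mem_Ioo, Set.mem_image, Subtype.exists,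
    mem_sphere_iff_norm, sub_zero, exists_and_right, exists_eq_right]
  constructor
  · rintro ⟨hS, h1, h0⟩
    have hx : 0 < ‖x‖ := norm_pos_iff.2 h0
    refine ⟨‖x‖, ⟨hx, h1⟩, ‖x‖⁻¹ • x, ⟨?_, hS⟩, ?_⟩
    · rw [norm_smul, norm_inv, norm_norm, inv_mul_cancel₀ hx.ne']
    · rw [smul_smul, mul_inv_cancel₀ hx.ne', one_smul]
  · rintro ⟨r, ⟨hr0, hr1⟩, y, ⟨hy, hS⟩, rfl⟩
    have hn : ‖r • y‖ = r := by rw [norm_smul, hy, mul_one, Real.norm_of_nonneg hr0.le]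
    refine ⟨?_, by rwa [hn], ?_⟩
    · rwa [hn, smul_smul, inv_mul_cancel₀ hr0.ne', one_smul]
    · intro h
      rw [h, norm_zero] at hn
      exact hr0.ne hn

/-- `toSphere` gives a set `d` times the volume of the cone over it, and the factor `d` cancels on
normalizing. Sphere integrals thus become Lebesgue integrals over the ball, where coordinates can be
separated. -/
theorem uniformSphere_eq_map_ball {d : ℕ} (hd : 0 < d) :
    uniformSphere d =
      (((volume (Metric.ball (0 : EuclideanSpace ℝ (Fin d)) 1))⁻¹ •
        volume.restrict (Metric.ball (0 : EuclideanSpace ℝ (Fin d)) 1)).map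
          (fun x => ‖x‖⁻¹ • x)) := by
  have hm : Measurable (fun x : EuclideanSpace ℝ (Fin d) => ‖x‖⁻¹ • x) := by fun_prop
  have : Nonempty (Fin d) := ⟨⟨0, hd⟩⟩
  ext S hS
  have hS' : MeasurableSet ((Subtype.val : Metric.sphere (0 : EuclideanSpace ℝ (Fin d)) 1 → _) ⁻¹' S) :=
    measurable_subtype_coe hS
  rw [Measure.map_apply hm hS, uniformSphere, Measure.map_apply measurable_subtype_coe hS]
  simp only [Measure.smul_apply, smul_eq_mul]
  rw [Measure.restrict_apply (hm hS), Measure.toSphere_apply' _ hS', ← preimage_ball_normalize,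
    Measure.toSphere_apply_univ, ← Set.inter_sdiff_assoc, measure_sdiff_null (measure_singleton _),
    ENNReal.mul_inv (Or.inr measure_ball_lt_top.ne) (Or.inl (ENNReal.natCast_ne_top _))]
  have h1 : ((Module.finrank ℝ (EuclideanSpace ℝ (Fin d)) : ℕ) : ENNReal)⁻¹ *
      (Module.finrank ℝ (EuclideanSpace ℝ (Fin d)) : ℕ) = 1 := by
    rw [finrank_euclideanSpace_fin]
    exact ENNReal.inv_mul_cancel (by exact_mod_cast hd.ne') (ENNReal.natCast_ne_top _)
  rw [mul_mul_mul_comm, h1, one_mul]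

instance {d : ℕ} : SFinite (uniformSphere d) := by
  unfold uniformSphere
  infer_instance

theorem isHermitian_transpose_mul {d : ℕ} (A : Matrix (Fin d) (Fin d) ℝ) :
    (Aᵀ * A).IsHermitian := by
  simpa using Matrix.isHermitian_conjTranspose_mul_self A

/-- `‖Ax‖²` is the quadratic form of `AᵀA`, while the spectrum in the statement is that of `AAᵀ`;
the two characteristic polynomials coincide. -/
theorem eigenvalues_transpose_mul {d : ℕ} (A : Matrix (Fin d) (Fin d) ℝ) :
    (isHermitian_transpose_mul A).eigenvalues = sigmaEigenvalues A :=
  ((isHermitian_transpose_mul A).eigenvalues_eq_eigenvalues_iff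
    (isHermitian_mul_transpose A)).2 (Matrix.charpoly_mul_comm _ _)

theorem sigmaEigenvalues_nonneg {d : ℕ} (A : Matrix (Fin d) (Fin d) ℝ) (i : Fin d) :
    0 ≤ sigmaEigenvalues A i := by
  have h : (A * Aᵀ).PosSemidef := by simpa using Matrix.posSemidef_self_mul_conjTranspose A
  exact h.eigenvalues_nonneg i

theorem norm_toEuclideanLin_sq {d : ℕ} (A : Matrix (Fin d) (Fin d) ℝ)
    (x : EuclideanSpace ℝ (Fin d)) :
    ‖Matrix.toEuclideanLin A x‖ ^ 2 = ∑ i, sigmaEigenvalues A i *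
      ((isHermitian_transpose_mul A).eigenvectorBasis.repr x i) ^ 2 := by
  set b := (isHermitian_transpose_mul A).eigenvectorBasis with hb
  have key : ∀ i, Matrix.toEuclideanLin (Aᵀ * A) (b i) = sigmaEigenvalues A i • b i := by
    intro i
    rw [← eigenvalues_transpose_mul]
    ext j
    have := congrFun ((isHermitian_transpose_mul A).mulVec_eigenvectorBasis i) j
    simpa [Matrix.toLpLin_apply] using this
  have h1 : inner ℝ (Matrix.toEuclideanLin A x) (Matrix.toEuclideanLin A x) =
      inner ℝ x (Matrix.toEuclideanLin (Aᵀ * A) x) := by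
    have h2 : Matrix.toEuclideanLin (Aᵀ * A) x =
        LinearMap.adjoint (Matrix.toEuclideanLin A) (Matrix.toEuclideanLin A x) := by
      rw [← Matrix.toEuclideanLin_conjTranspose_eq_adjoint]
      simp [Matrix.toLpLin_apply]
    rw [h2, LinearMap.adjoint_inner_right]
  rw [← real_inner_self_eq_norm_sq, h1]
  conv_lhs => rw [← b.sum_repr x, map_sum, b.sum_repr x, inner_sum]
  refine Finset.sum_congr rfl fun i _ => ?_
  rw [map_smul, key, real_inner_smul_right, real_inner_smul_right, real_inner_comm,
    ← b.repr_apply_apply]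
  ring

theorem sigmaEigenvalues_le_top {d : ℕ} (A : Matrix (Fin d) (Fin d) ℝ) (i : Fin d) :
    sigmaEigenvalues A i ≤ topEigenvalue A :=
  le_ciSup (Set.finite_range _).bddAbove i

theorem exists_sigmaEigenvalues_eq_top {d : ℕ} (hd : 0 < d) (A : Matrix (Fin d) (Fin d) ℝ) :
    ∃ i, sigmaEigenvalues A i = topEigenvalue A := by
  have : Nonempty (Fin d) := ⟨⟨0, hd⟩⟩
  exact exists_eq_ciSup_of_finite

theorem measurable_smul_toEuclideanLin {d : ℕ} (A : Matrix (Fin d) (Fin d) ℝ) :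
    Measurable (fun p : ℝ × EuclideanSpace ℝ (Fin d) => p.1 • Matrix.toEuclideanLin A p.2) := by
  have h : Continuous (Matrix.toEuclideanLin A) := LinearMap.continuous_of_finiteDimensional _
  exact (continuous_fst.smul (h.comp continuous_snd)).measurable

/-- Passing to an orthonormal eigenbasis of `AᵀA` preserves both Lebesgue measure and the ball, so
only the eigenvalues of `A` matter. -/
theorem ellipticalLaw_norm_ge {d : ℕ} (hd : 0 < d) (A : Matrix (Fin d) (Fin d) ℝ)
    (ν : Measure ℝ) [IsProbabilityMeasure ν] (u : ℝ) :
    ellipticalLaw A ν {x | u ≤ ‖x‖} =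
      (volume (Metric.ball (0 : EuclideanSpace ℝ (Fin d)) 1))⁻¹ *
        ∫⁻ y in Metric.ball (0 : EuclideanSpace ℝ (Fin d)) 1,
          ν {r | u ≤ |r| * (√(∑ i, sigmaEigenvalues A i * y i ^ 2) / ‖y‖)} := by
  have hS : MeasurableSet {x : EuclideanSpace ℝ (Fin d) | u ≤ ‖x‖} :=
    measurableSet_le measurable_const measurable_norm
  have hm := measurable_smul_toEuclideanLin A
  have hn : Measurable (fun x : EuclideanSpace ℝ (Fin d) => ‖x‖⁻¹ • x) := by fun_prop
  rw [ellipticalLaw, Measure.map_apply hm hS, Measure.prod_apply_symm (hm hS),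
    uniformSphere_eq_map_ball hd, lintegral_map (measurable_measure_prodMk_right (hm hS)) hn,
    lintegral_smul_measure, smul_eq_mul]
  congr 1
  set b := (isHermitian_transpose_mul A).eigenvectorBasis
  have hball : b.repr ⁻¹' Metric.ball 0 1 = Metric.ball 0 1 := by
    ext x
    simp
  have hcomp := b.measurePreserving_repr.setLIntegral_comp_preimage_emb
    b.repr.toHomeomorph.measurableEmbedding
    (fun y => ν {r | u ≤ |r| * (√(∑ i, sigmaEigenvalues A i * y i ^ 2) / ‖y‖)}) (Metric.ball 0 1)
  rw [← hcomp, hball]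
  refine lintegral_congr fun x => ?_
  congr 1
  ext r
  simp only [Set.mem_preimage, Set.mem_ofPred_eq]
  rw [← norm_toEuclideanLin_sq, Real.sqrt_sq (norm_nonneg _), map_smul, norm_smul, norm_smul,
    norm_inv, norm_norm, Real.norm_eq_abs, b.repr.norm_map, inv_mul_eq_div]

/-! ### Laplace-type estimates on the ball. -/

open scoped Classical in
theorem sum_ite_zero_neg_half {ι : Type*} [Fintype ι] (l : ι → ℝ) :
    ∑ i, (if l i = 1 then (0 : ℝ) else -1 / 2) =
      -((Fintype.card ι : ℝ) - (Nat.card {i // l i = 1} : ℝ)) / 2 := by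
  have h1 : ∀ i, (if l i = 1 then (0 : ℝ) else -1 / 2) =
      (if l i = 1 then (1 : ℝ) else 0) / 2 - 1 / 2 := by
    intro i
    split_ifs <;> norm_num
  simp_rw [h1]
  rw [Finset.sum_sub_distrib, ← Finset.sum_div, Finset.sum_boole, Nat.card_eq_fintype_card,
    Fintype.card_subtype]
  simp
  ring

/-- Gaussian-type bound for the Laplace transform of a degenerate quadratic form on a box. -/
theorem exists_lintegral_exp_neg_le {ι : Type*} [Fintype ι] (l : ι → ℝ) (hl : ∀ i, l i ≤ 1)
    {κ : ℝ} (hκ : 0 < κ) :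
    ∃ C : ℝ, 0 < C ∧ ∀ t : ℝ, 0 < t →
      ∫⁻ y in Metric.ball (0 : EuclideanSpace ℝ ι) 1,
        ENNReal.ofReal (Real.exp (-(κ * t * ∑ i, (1 - l i) * y i ^ 2))) ≤
      ENNReal.ofReal (C * t ^ (-((Fintype.card ι : ℝ) - (Nat.card {i // l i = 1} : ℝ)) / 2)) := by
  classical
  -- One-dimensional integrals: the length of `[-1, 1]` in a top direction, otherwise the constant
  -- of a full Gaussian integral.
  let a : ι → ℝ := fun i => if l i = 1 then 2 else √(Real.pi / (κ * (1 - l i)))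
  have ha : ∀ i, 0 < a i := by
    intro i
    by_cases h : l i = 1
    · simp [a, h]
    · have : 0 < 1 - l i := sub_pos.2 (lt_of_le_of_ne (hl i) h)
      simp only [a, h, if_false]
      positivity
  refine ⟨∏ i, a i, Finset.prod_pos fun i _ => ha i, fun t ht => ?_⟩
  let f : ι → ℝ → ℝ := fun i z =>
    if l i = 1 then (Set.Icc (-1 : ℝ) 1).indicator 1 z else Real.exp (-(κ * t * (1 - l i)) * z ^ 2)
  have hf0 : ∀ i z, 0 ≤ f i z := by
    intro i z
    by_cases h : l i = 1
    · simp only [f, h, if_true]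
      exact Set.indicator_nonneg (fun _ _ => zero_le_one) _
    · simp only [f, h, if_false]
      positivity
  have hfi : ∀ i, Integrable (f i) := by
    intro i
    by_cases h : l i = 1
    · simp only [f, h, if_true]
      exact (integrable_indicator_iff measurableSet_Icc).2 (integrableOn_const (by simp))
    · have : 0 < 1 - l i := sub_pos.2 (lt_of_le_of_ne (hl i) h)
      simp only [f, h, if_false]
      exact integrable_exp_neg_mul_sq (by positivity)
  have hfv : ∀ i, ∫ z, f i z = a i * t ^ (if l i = 1 then (0 : ℝ) else -1 / 2) := by
    intro i
    by_cases h : l i = 1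
    · simp only [f, a, h, if_true, Real.rpow_zero, mul_one]
      rw [integral_indicator measurableSet_Icc]
      simp
      norm_num
    · have : 0 < 1 - l i := sub_pos.2 (lt_of_le_of_ne (hl i) h)
      simp only [f, a, h, if_false]
      rw [integral_gaussian, neg_div, Real.rpow_neg ht.le, ← Real.sqrt_eq_rpow, ← Real.sqrt_inv,
        ← Real.sqrt_mul (by positivity)]
      congr 1
      field_simp
  have hsum := sum_ite_zero_neg_half l
  have hF : Integrable (fun y : ι → ℝ => ∏ i, f i (y i)) := Integrable.fintype_prod hfi
  calc ∫⁻ y in Metric.ball (0 : EuclideanSpace ℝ ι) 1,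
        ENNReal.ofReal (Real.exp (-(κ * t * ∑ i, (1 - l i) * y i ^ 2)))
      ≤ ∫⁻ y in Metric.ball (0 : EuclideanSpace ℝ ι) 1, ENNReal.ofReal (∏ i, f i (y i)) := by
        refine setLIntegral_mono' measurableSet_ball fun y hy => ENNReal.ofReal_le_ofReal ?_
        rw [Finset.mul_sum, ← Finset.sum_neg_distrib, Real.exp_sum]
        refine Finset.prod_le_prod (fun i _ => (Real.exp_pos _).le) fun i _ => ?_
        by_cases h : l i = 1
        · have hyi : |y i| ≤ 1 := by
            have := PiLp.norm_apply_le y i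
            rw [Real.norm_eq_abs] at this
            exact this.trans (mem_ball_zero_iff.1 hy).le
          have : y i ∈ Set.Icc (-1 : ℝ) 1 := abs_le.1 hyi
          simp [f, h, this]
        · simp only [f, h, if_false]
          apply le_of_eq
          congr 1
          ring
    _ ≤ ∫⁻ y : EuclideanSpace ℝ ι, ENNReal.ofReal (∏ i, f i (y i)) := setLIntegral_le_lintegral _ _
    _ = ∫⁻ y : ι → ℝ, ENNReal.ofReal (∏ i, f i (y i)) :=
        (PiLp.volume_preserving_ofLp ι).lintegral_comp_emb
          (MeasurableEquiv.toLp 2 (ι → ℝ)).symm.measurableEmbedding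
          (fun y => ENNReal.ofReal (∏ i, f i (y i)))
    _ = ENNReal.ofReal (∫ y : ι → ℝ, ∏ i, f i (y i)) :=
        (ofReal_integral_eq_lintegral_ofReal hF
          (Eventually.of_forall fun y => Finset.prod_nonneg fun i _ => hf0 i _)).symm
    _ = _ := by
        rw [integral_fintype_prod_volume_eq_prod]
        simp_rw [hfv]
        rw [Finset.prod_mul_distrib, ← Real.rpow_sum_of_pos ht, hsum]

/-- The points of the unit ball whose direction is within order `1 / √t` of the top eigenspace, of
dimension `m`, contain a set of volume at least of order `t ^ (-(n - m) / 2)`. -/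
theorem exists_volume_near_top_ge {ι : Type*} [Fintype ι] (l : ι → ℝ) (hl0 : ∀ i, 0 ≤ l i)
    (hl : ∃ i, l i = 1) (hcard : 2 ≤ Fintype.card ι) {ε : ℝ} (hε : 0 < ε) (hε1 : ε ≤ 1) :
    ∃ C : ℝ, 0 < C ∧ ∀ t : ℝ, 1 ≤ t → ∃ D : Set (EuclideanSpace ℝ ι), MeasurableSet D ∧
      D ⊆ Metric.ball 0 1 ∧ (∀ y ∈ D, y ≠ 0) ∧
      (∀ y ∈ D, (1 - ε / t) * ‖y‖ ^ 2 ≤ ∑ i, l i * y i ^ 2) ∧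
      ENNReal.ofReal (C * t ^ (-((Fintype.card ι : ℝ) - (Nat.card {i // l i = 1} : ℝ)) / 2)) ≤
        volume D := by
  classical
  obtain ⟨n, hn⟩ : ∃ n : ℝ, n = (Fintype.card ι : ℝ) := ⟨_, rfl⟩
  rw [← hn]
  have hn2 : (2 : ℝ) ≤ n := by rw [hn]; exact_mod_cast hcard
  have hn0 : 0 < n := by linarith
  let a : ι → ℝ := fun i => if l i = 1 then 1 / (2 * n) else √ε / n ^ 2
  have ha : ∀ i, 0 < a i := by
    intro i
    by_cases h : l i = 1
    · simp only [a, h, if_true]; positivity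
    · simp only [a, h, if_false]; positivity
  refine ⟨∏ i, a i, Finset.prod_pos fun i _ => ha i, fun t ht => ?_⟩
  have ht0 : 0 < t := by linarith
  -- The half-width is small enough that up to `n` terms `y i ^ 2` sum to at most `(ε / t) / (4 n ^
  -- 2)`, while the top coordinate `i₀` alone gives `‖y‖ ^ 2 ≥ 1 / (4 n ^ 2)`.
  set h : ℝ := √(ε / t) / (2 * n ^ 2) with hh
  have h0 : 0 ≤ h := by positivity
  have hsq : h ^ 2 = ε / t / (4 * n ^ 4) := by
    rw [hh, div_pow, Real.sq_sqrt (by positivity)]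
    ring
  have hεt : ε / t ≤ 1 := (div_le_one ht0).2 (hε1.trans ht)
  have hεt0 : 0 < ε / t := by positivity
  let B : ι → Set ℝ := fun i => if l i = 1 then Set.Icc (1 / (2 * n)) (1 / n) else Set.Icc (-h) h
  have hBm : MeasurableSet (Set.univ.pi B) := by
    refine MeasurableSet.univ_pi fun i => ?_
    by_cases hi : l i = 1
    · simp only [B, hi, if_true]; exact measurableSet_Icc
    · simp only [B, hi, if_false]; exact measurableSet_Icc
  have hmp := PiLp.volume_preserving_ofLp ι
  have hmem : ∀ y : EuclideanSpace ℝ ι, y ∈ WithLp.ofLp ⁻¹' Set.univ.pi B →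
      (∀ i, l i = 1 → 1 / (2 * n) ≤ y i ∧ y i ≤ 1 / n) ∧
      (∀ i, l i ≠ 1 → y i ^ 2 ≤ ε / t / (4 * n ^ 4)) := by
    intro y hy
    have hy' : ∀ i, y i ∈ B i := by simpa using hy
    refine ⟨fun i hi => ?_, fun i hi => ?_⟩
    · have := hy' i
      simp only [B, hi, if_true] at this
      exact this
    · have := hy' i
      simp only [B, hi, if_false] at this
      rw [← hsq]
      exact sq_le_sq' this.1 this.2
  obtain ⟨i₀, hi₀⟩ := hl
  have hnorm : ∀ y : EuclideanSpace ℝ ι, y ∈ WithLp.ofLp ⁻¹' Set.univ.pi B →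
      1 / (4 * n ^ 2) ≤ ‖y‖ ^ 2 := by
    intro y hy
    rw [EuclideanSpace.real_norm_sq_eq]
    have h1 := Finset.single_le_sum (f := fun i => y i ^ 2) (fun i _ => sq_nonneg (y i))
      (Finset.mem_univ i₀)
    have h2 : (1 / (2 * n)) ^ 2 ≤ y i₀ ^ 2 :=
      pow_le_pow_left₀ (by positivity) ((hmem y hy).1 i₀ hi₀).1 2
    have h3 : (1 / (2 * n)) ^ 2 = 1 / (4 * n ^ 2) := by ring
    rw [h3] at h2
    exact h2.trans h1
  refine ⟨WithLp.ofLp ⁻¹' Set.univ.pi B, hmp.measurable hBm, ?_, ?_, ?_, ?_⟩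
  · intro y hy
    rw [mem_ball_zero_iff]
    have h1 : ‖y‖ ^ 2 < 1 := by
      rw [EuclideanSpace.real_norm_sq_eq]
      calc ∑ i, y i ^ 2 ≤ ∑ _i : ι, 1 / n ^ 2 := by
            refine Finset.sum_le_sum fun i _ => ?_
            by_cases hi : l i = 1
            · obtain ⟨h1, h2⟩ := (hmem y hy).1 i hi
              have h3 : 0 ≤ y i := le_trans (by positivity) h1
              calc y i ^ 2 ≤ (1 / n) ^ 2 := pow_le_pow_left₀ h3 h2 2
                _ = 1 / n ^ 2 := by ring
            · refine ((hmem y hy).2 i hi).trans ?_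
              rw [div_le_div_iff₀ (by positivity) (by positivity)]
              have : n ^ 2 * 1 ≤ n ^ 2 * n ^ 2 :=
                mul_le_mul_of_nonneg_left (by nlinarith) (by positivity)
              nlinarith [mul_le_mul_of_nonneg_right hεt (sq_nonneg n)]
        _ = 1 / n := by
            rw [Finset.sum_const, Finset.card_univ, nsmul_eq_mul, ← hn]
            field_simp
        _ < 1 := by rw [div_lt_one hn0]; linarith
    exact (sq_lt_one_iff₀ (norm_nonneg _)).1 h1
  · intro y hy h00
    have := hnorm y hy
    rw [h00, norm_zero, zero_pow two_ne_zero] at this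
    exact this.not_gt (by positivity)
  · intro y hy
    have h1 : ∑ i, (1 - l i) * y i ^ 2 ≤ ∑ _i : ι, ε / t / (4 * n ^ 4) := by
      refine Finset.sum_le_sum fun i _ => ?_
      by_cases hi : l i = 1
      · rw [hi, sub_self, zero_mul]; positivity
      · refine le_trans ?_ ((hmem y hy).2 i hi)
        nlinarith [mul_nonneg (hl0 i) (sq_nonneg (y i))]
    rw [Finset.sum_const, Finset.card_univ, nsmul_eq_mul, ← hn] at h1
    have h2 : n * (ε / t / (4 * n ^ 4)) ≤ ε / t * (1 / (4 * n ^ 2)) := by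
      rw [show n * (ε / t / (4 * n ^ 4)) = ε / t * (1 / (4 * n ^ 3)) by field_simp]
      refine mul_le_mul_of_nonneg_left ?_ hεt0.le
      apply one_div_le_one_div_of_le (by positivity)
      have : n ^ 2 * 1 ≤ n ^ 2 * n := mul_le_mul_of_nonneg_left (by linarith) (by positivity)
      nlinarith
    have h3 := mul_le_mul_of_nonneg_left (hnorm y hy) hεt0.le
    have h4 : ∑ i, (1 - l i) * y i ^ 2 = ‖y‖ ^ 2 - ∑ i, l i * y i ^ 2 := by
      rw [EuclideanSpace.real_norm_sq_eq, ← Finset.sum_sub_distrib]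
      exact Finset.sum_congr rfl fun i _ => by ring
    rw [h4] at h1
    linarith
  · have hv : ∀ i, volume (B i) = ENNReal.ofReal
        (a i * t ^ (if l i = 1 then (0 : ℝ) else -1 / 2)) := by
      intro i
      by_cases hi : l i = 1
      · simp only [B, a, hi, if_true, Real.rpow_zero, mul_one, Real.volume_Icc]
        congr 1
        field_simp
        norm_num
      · simp only [B, a, hi, if_false, Real.volume_Icc]
        congr 1
        rw [neg_div, Real.rpow_neg ht0.le, ← Real.sqrt_eq_rpow, hh, Real.sqrt_div hε.le]
        field_simp
        norm_num
    have hsum := sum_ite_zero_neg_half l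
    rw [← hn] at hsum
    rw [hmp.measure_preimage hBm.nullMeasurableSet, volume_pi_pi]
    simp_rw [hv]
    rw [← ENNReal.ofReal_prod_of_nonneg fun i _ => mul_nonneg (ha i).le (by positivity),
      Finset.prod_mul_distrib, ← Real.rpow_sum_of_pos ht0, hsum]

/-! ### Tail of the radius at a perturbed level. -/

/-- The logarithmic derivative `M / s - b` is nonpositive once `s ≥ |M| / b`. -/
theorem rpow_mul_exp_neg_le {M b s t : ℝ} (hb : 0 < b) (ht : 0 < t) (hM : |M| ≤ b * t)
    (hst : t ≤ s) : s ^ M * Real.exp (-(b * s)) ≤ t ^ M * Real.exp (-(b * t)) := by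
  have hs : 0 < s := ht.trans_le hst
  have h1 : 1 ≤ s / t := (one_le_div ht).2 hst
  have h2 : (s / t) ^ M ≤ Real.exp (b * s - b * t) := by
    calc (s / t) ^ M ≤ (s / t) ^ |M| := Real.rpow_le_rpow_of_exponent_le h1 (le_abs_self M)
      _ ≤ (Real.exp (s / t - 1)) ^ |M| := by
          refine Real.rpow_le_rpow (by positivity) ?_ (abs_nonneg M)
          linarith [Real.add_one_le_exp (s / t - 1)]
      _ = Real.exp ((s / t - 1) * |M|) := by rw [← Real.exp_mul]
      _ ≤ Real.exp ((s / t - 1) * (b * t)) :=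
          Real.exp_le_exp.2 (mul_le_mul_of_nonneg_left hM (by linarith))
      _ = Real.exp (b * s - b * t) := by
          congr 1
          field_simp
  rw [Real.div_rpow hs.le ht.le, div_le_iff₀ (by positivity)] at h2
  calc s ^ M * Real.exp (-(b * s))
      ≤ Real.exp (b * s - b * t) * t ^ M * Real.exp (-(b * s)) :=
        mul_le_mul_of_nonneg_right h2 (Real.exp_pos _).le
    _ = t ^ M * (Real.exp (b * s - b * t) * Real.exp (-(b * s))) := by ring
    _ = t ^ M * Real.exp (-(b * t)) := by
        rw [← Real.exp_add]
        ring_nf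

namespace IsKotzIIIRadius

variable {ν : Measure ℝ} {c N δ τ : ℝ}

theorem eventually_tail_bounds (hν : IsKotzIIIRadius ν c N δ τ) (hc : 0 < c) (hτ : 0 < τ) :
    ∀ᶠ t : ℝ in atTop,
      c / 2 * (t ^ (N / τ) * Real.exp (-(δ * t))) ≤ ν.real (Set.Ioi (t ^ (1 / τ))) ∧
      ν.real (Set.Ioi (t ^ (1 / τ))) ≤ 2 * c * (t ^ (N / τ) * Real.exp (-(δ * t))) := by
  have h := (hν.tail.isLittleO.def (by norm_num : (0 : ℝ) < 1 / 2))
  filter_upwards [(tendsto_rpow_atTop (one_div_pos.2 hτ)).eventually h, eventually_gt_atTop 0]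
    with t ht ht0
  have h1 : (t ^ (1 / τ)) ^ N = t ^ (N / τ) := by
    rw [← Real.rpow_mul ht0.le]
    congr 1
    ring
  have h2 : (t ^ (1 / τ)) ^ τ = t := by
    rw [← Real.rpow_mul ht0.le, one_div_mul_cancel hτ.ne', Real.rpow_one]
  have hg : 0 < t ^ (N / τ) * Real.exp (-(δ * t)) := by positivity
  rw [Pi.sub_apply, h1, h2, neg_mul, mul_assoc c, Real.norm_eq_abs, Real.norm_eq_abs,
    abs_of_pos (mul_pos hc hg), abs_le] at ht
  constructor <;> nlinarith [ht.1, ht.2, mul_pos hc hg]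

theorem eventually_closed_tail_le (hν : IsKotzIIIRadius ν c N δ τ) (hc : 0 < c) (hτ : 0 < τ) :
    ∀ᶠ t : ℝ in atTop,
      ν.real (Set.Ici (t ^ (1 / τ))) ≤ 2 * c * (t ^ (N / τ) * Real.exp (-(δ * t))) := by
  have := hν.isProbabilityMeasure
  obtain ⟨t₀, h₀⟩ := eventually_atTop.1 (hν.eventually_tail_bounds hc hτ)
  filter_upwards [eventually_gt_atTop t₀, eventually_gt_atTop 0] with t ht ht0
  have hcont : ContinuousAt (fun t : ℝ => 2 * c * (t ^ (N / τ) * Real.exp (-(δ * t)))) t := by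
    have := Real.continuousAt_rpow_const t (N / τ) (Or.inl ht0.ne')
    fun_prop
  -- The closed tail at `t` lies in every open tail at `s < t`; let `s` increase to `t` in the
  -- continuous bound.
  refine ge_of_tendsto (hcont.tendsto.mono_left (nhdsWithin_le_nhds (s := Set.Iio t))) ?_
  filter_upwards [self_mem_nhdsWithin, nhdsWithin_le_nhds (Ioi_mem_nhds ht),
    nhdsWithin_le_nhds (Ioi_mem_nhds ht0)] with s hs hs0 hs1
  refine le_trans (measureReal_mono fun x hx => ?_) (h₀ s (le_of_lt hs0)).2
  exact lt_of_lt_of_le (Real.rpow_lt_rpow (le_of_lt hs1) hs (one_div_pos.2 hτ)) hx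

/-- If `r g` reaches the level `t ^ (1 / τ)` and `g ^ 2 ≤ 1 - q`, then `r ^ τ` exceeds `t` by at
least a multiple of `t q`. -/
theorem _root_.rpow_le_of_le_mul {τ t r g q : ℝ} (hτ : 0 < τ) (ht : 0 < t) (hr : 0 < r)
    (hg : 0 ≤ g) (hq : 0 ≤ q) (hgq : g ^ 2 ≤ 1 - q) (h : t ^ (1 / τ) ≤ r * g) :
    (t * (1 + τ / 2 * q)) ^ (1 / τ) ≤ r := by
  have h1 : g ^ τ * (1 + τ / 2 * q) ≤ 1 := by
    have h2 : g ^ τ ≤ Real.exp (-(τ / 2 * q)) := by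
      calc g ^ τ = (g ^ 2) ^ (τ / 2) := by
            rw [← Real.rpow_natCast, ← Real.rpow_mul hg]
            congr 1
            push_cast
            ring
        _ ≤ (Real.exp (-q)) ^ (τ / 2) := by
            refine Real.rpow_le_rpow (sq_nonneg g) ?_ (by positivity)
            linarith [Real.add_one_le_exp (-q)]
        _ = Real.exp (-(τ / 2 * q)) := by
            rw [← Real.exp_mul]
            congr 1
            ring
    calc g ^ τ * (1 + τ / 2 * q) ≤ Real.exp (-(τ / 2 * q)) * Real.exp (τ / 2 * q) := by
          refine mul_le_mul h2 ?_ (by positivity) (Real.exp_pos _).le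
          linarith [Real.add_one_le_exp (τ / 2 * q)]
      _ = 1 := by rw [← Real.exp_add, neg_add_cancel, Real.exp_zero]
  have h3 : t ≤ r ^ τ * g ^ τ := by
    have := Real.rpow_le_rpow (by positivity) h hτ.le
    rwa [← Real.rpow_mul ht.le, one_div_mul_cancel hτ.ne', Real.rpow_one,
      Real.mul_rpow hr.le hg] at this
  have h4 : t * (1 + τ / 2 * q) ≤ r ^ τ := by
    calc t * (1 + τ / 2 * q) ≤ r ^ τ * g ^ τ * (1 + τ / 2 * q) :=
          mul_le_mul_of_nonneg_right h3 (by positivity)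
      _ = r ^ τ * (g ^ τ * (1 + τ / 2 * q)) := by ring
      _ ≤ r ^ τ * 1 := mul_le_mul_of_nonneg_left h1 (by positivity)
      _ = r ^ τ := mul_one _
  calc (t * (1 + τ / 2 * q)) ^ (1 / τ) ≤ (r ^ τ) ^ (1 / τ) :=
        Real.rpow_le_rpow (by positivity) h4 (by positivity)
    _ = r := by rw [← Real.rpow_mul hr.le, mul_one_div_cancel hτ.ne', Real.rpow_one]

/-- The window `1 / ((τ + 1) t)` is narrow enough to force `g ^ τ ≥ 1 - 1 / (2 t)`, a loss
compensated by raising `t` by one. That shift costs the radial tail only a constant factor. -/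
theorem _root_.rpow_le_add_one_rpow_mul {τ t g : ℝ} (hτ : 0 < τ) (ht : 1 ≤ t) (hg : 0 ≤ g)
    (h : 1 - 1 / (τ + 1) / t ≤ g ^ 2) : t ^ (1 / τ) ≤ (t + 1) ^ (1 / τ) * g := by
  have ht0 : 0 < t := by linarith
  have h1 : t ≤ (t + 1) * g ^ τ := by
    have h2 : Real.exp (-(1 / (τ * t))) ≤ 1 - 1 / (τ + 1) / t := by
      have h5 : 0 < 1 / (τ * t) := by positivity
      have h6 : Real.exp (-(1 / (τ * t))) ≤ 1 / (1 + 1 / (τ * t)) := by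
        rw [Real.exp_neg, ← one_div]
        exact one_div_le_one_div_of_le (by positivity)
          (by linarith [Real.add_one_le_exp (1 / (τ * t))])
      refine h6.trans ?_
      have h7 : 1 / (1 + 1 / (τ * t)) = 1 - 1 / (τ * t + 1) := by
        field_simp
        ring
      rw [h7, div_div]
      have h8 : 1 / ((τ + 1) * t) ≤ 1 / (τ * t + 1) :=
        one_div_le_one_div_of_le (by positivity) (by nlinarith)
      linarith
    have h3 : Real.exp (-(1 / (2 * t))) ≤ g ^ τ := by
      calc Real.exp (-(1 / (2 * t))) = (Real.exp (-(1 / (τ * t)))) ^ (τ / 2) := by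
            rw [← Real.exp_mul]
            congr 1
            field_simp
        _ ≤ (g ^ 2) ^ (τ / 2) :=
            Real.rpow_le_rpow (Real.exp_pos _).le (h2.trans h) (by positivity)
        _ = g ^ τ := by
            rw [← Real.rpow_natCast, ← Real.rpow_mul hg]
            congr 1
            push_cast
            ring
    have h4 : 1 - 1 / (2 * t) ≤ g ^ τ := by
      linarith [Real.add_one_le_exp (-(1 / (2 * t)))]
    have h9 : t ≤ (t + 1) * (1 - 1 / (2 * t)) := by
      have : (t + 1) * (1 - 1 / (2 * t)) - t = (t - 1) / (2 * t) := by
        field_simp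
        ring
      have : 0 ≤ (t - 1) / (2 * t) := div_nonneg (by linarith) (by positivity)
      linarith
    exact h9.trans (mul_le_mul_of_nonneg_left h4 (by positivity))
  calc t ^ (1 / τ) ≤ ((t + 1) * g ^ τ) ^ (1 / τ) := Real.rpow_le_rpow ht0.le h1 (by positivity)
    _ = (t + 1) ^ (1 / τ) * g := by
        rw [Real.mul_rpow (by positivity) (by positivity), ← Real.rpow_mul hg,
          mul_one_div_cancel hτ.ne', Real.rpow_one]

theorem eventually_scaled_tail_le (hν : IsKotzIIIRadius ν c N δ τ) (hc : 0 < c) (hδ : 0 < δ)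
    (hτ : 0 < τ) :
    ∀ᶠ t : ℝ in atTop, ∀ g q : ℝ, 0 ≤ g → 0 ≤ q → g ^ 2 ≤ 1 - q →
      ν {r | t ^ (1 / τ) ≤ |r| * g} ≤ ENNReal.ofReal (2 * c * (t ^ (N / τ) * Real.exp (-(δ * t))))
        * ENNReal.ofReal (Real.exp (-(δ * τ / 4 * t * q))) := by
  have := hν.isProbabilityMeasure
  obtain ⟨t₀, h₀⟩ := eventually_atTop.1 (hν.eventually_closed_tail_le hc hτ)
  filter_upwards [eventually_ge_atTop t₀, eventually_gt_atTop 0,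
    eventually_ge_atTop (|N / τ| / (δ / 2))] with t ht ht0 htM g q hg hq hgq
  set t' := t * (1 + τ / 2 * q) with ht'
  have htt' : t ≤ t' := by
    have : 0 ≤ t * (τ / 2 * q) := by positivity
    rw [ht']
    linarith
  have hsub : {r | t ^ (1 / τ) ≤ |r| * g} ≤ᵐ[ν] Set.Ici (t' ^ (1 / τ)) := by
    have hpos : ∀ᵐ r ∂ν, r ∉ Set.Iic (0 : ℝ) := measure_eq_zero_iff_ae_notMem.1 hν.pos
    filter_upwards [hpos] with r hr h
    have hr0 : 0 < r := not_le.1 hr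
    have h' : t ^ (1 / τ) ≤ |r| * g := h
    rw [abs_of_pos hr0] at h'
    exact rpow_le_of_le_mul hτ ht0 hr0 hg hq hgq h'
  rw [← ENNReal.ofReal_mul (by positivity)]
  refine (measure_mono_ae hsub).trans ?_
  rw [← ofReal_measureReal]
  refine ENNReal.ofReal_le_ofReal ((h₀ t' (ht.trans htt')).trans ?_)
  have hmono := rpow_mul_exp_neg_le (M := N / τ) (half_pos hδ) ht0
    (by rwa [div_le_iff₀' (half_pos hδ)] at htM) htt'
  -- One half of the exponential absorbs the power of `t'`; the other half keeps the gain `δ / 2 *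
  -- (t' - t) = δ * τ / 4 * t * q`.
  have e1 : Real.exp (-(δ * t')) = Real.exp (-(δ / 2 * t')) * Real.exp (-(δ / 2 * t')) := by
    rw [← Real.exp_add]
    ring_nf
  have e2 : Real.exp (-(δ / 2 * t)) * Real.exp (-(δ / 2 * t')) =
      Real.exp (-(δ * t)) * Real.exp (-(δ * τ / 4 * t * q)) := by
    rw [← Real.exp_add, ← Real.exp_add, ht']
    ring_nf
  calc 2 * c * (t' ^ (N / τ) * Real.exp (-(δ * t')))
      = 2 * c * ((t' ^ (N / τ) * Real.exp (-(δ / 2 * t'))) * Real.exp (-(δ / 2 * t'))) := by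
        rw [e1]
        ring
    _ ≤ 2 * c * ((t ^ (N / τ) * Real.exp (-(δ / 2 * t))) * Real.exp (-(δ / 2 * t'))) := by
        gcongr
    _ = 2 * c * (t ^ (N / τ) * Real.exp (-(δ * t))) * Real.exp (-(δ * τ / 4 * t * q)) := by
        rw [mul_assoc (t ^ (N / τ)), e2]
        ring

theorem exists_eventually_le_scaled_tail (hν : IsKotzIIIRadius ν c N δ τ) (hc : 0 < c)
    (hτ : 0 < τ) :
    ∃ C : ℝ, 0 < C ∧ ∀ᶠ t : ℝ in atTop, ∀ g : ℝ, 0 ≤ g → 1 - 1 / (τ + 1) / t ≤ g ^ 2 →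
      ENNReal.ofReal (C * (t ^ (N / τ) * Real.exp (-(δ * t)))) ≤
        ν {r | t ^ (1 / τ) ≤ |r| * g} := by
  have := hν.isProbabilityMeasure
  refine ⟨c / 2 * (2 ^ (-|N / τ|) * Real.exp (-δ)), by positivity, ?_⟩
  filter_upwards [(tendsto_atTop_add_const_right _ (1 : ℝ) tendsto_id).eventually
    (hν.eventually_tail_bounds hc hτ), eventually_ge_atTop 1] with t ht ht1 g hg hgt
  simp only [id] at ht
  have ht0 : 0 < t := by linarith
  have hsub : Set.Ioi ((t + 1) ^ (1 / τ)) ⊆ {r | t ^ (1 / τ) ≤ |r| * g} := by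
    intro r hr
    have hr' : (t + 1) ^ (1 / τ) < r := hr
    exact (rpow_le_add_one_rpow_mul hτ ht1 hg hgt).trans
      (mul_le_mul_of_nonneg_right (hr'.le.trans (le_abs_self r)) hg)
  refine le_trans ?_ (measure_mono hsub)
  rw [← ofReal_measureReal]
  refine ENNReal.ofReal_le_ofReal (le_trans ?_ ht.1)
  have h1 : 2 ^ (-|N / τ|) * t ^ (N / τ) ≤ (t + 1) ^ (N / τ) := by
    have h2 : (2 : ℝ) ^ (-|N / τ|) ≤ ((t + 1) / t) ^ (N / τ) := by
      have h3 : 1 ≤ (t + 1) / t := (one_le_div ht0).2 (by linarith)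
      have h4 : (t + 1) / t ≤ 2 := (div_le_iff₀ ht0).2 (by linarith)
      calc (2 : ℝ) ^ (-|N / τ|) ≤ ((t + 1) / t) ^ (-|N / τ|) :=
            Real.rpow_le_rpow_of_nonpos (by positivity) h4 (neg_nonpos.2 (abs_nonneg _))
        _ ≤ ((t + 1) / t) ^ (N / τ) :=
            Real.rpow_le_rpow_of_exponent_le h3 (neg_abs_le _)
    rwa [Real.div_rpow (by positivity) ht0.le, le_div_iff₀ (by positivity)] at h2
  have h5 : Real.exp (-(δ * (t + 1))) = Real.exp (-δ) * Real.exp (-(δ * t)) := by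
    rw [← Real.exp_add]
    ring_nf
  rw [h5]
  calc c / 2 * (2 ^ (-|N / τ|) * Real.exp (-δ)) * (t ^ (N / τ) * Real.exp (-(δ * t)))
      = c / 2 * ((2 ^ (-|N / τ|) * t ^ (N / τ)) * (Real.exp (-δ) * Real.exp (-(δ * t)))) := by
        ring
    _ ≤ _ := by gcongr

end IsKotzIIIRadius

/-! ### Two-sided bounds for the tail of the norm. -/

theorem topMultiplicity_eq {d : ℕ} {A : Matrix (Fin d) (Fin d) ℝ} (hA : topEigenvalue A = 1) :
    topMultiplicity A = Nat.card {i // sigmaEigenvalues A i = 1} := by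
  rw [topMultiplicity, hA]

theorem exists_ellipticalLaw_tail_le {d : ℕ} (hd : 2 ≤ d) (A : Matrix (Fin d) (Fin d) ℝ)
    (hA : topEigenvalue A = 1) {c N δ τ : ℝ} (hc : 0 < c) (hδ : 0 < δ) (hτ : 0 < τ)
    {ν : Measure ℝ} (hν : IsKotzIIIRadius ν c N δ τ) :
    ∃ C : ℝ, 0 < C ∧ ∀ᶠ t : ℝ in atTop,
      (ellipticalLaw A ν).real {x | t ^ (1 / τ) ≤ ‖x‖} ≤
        C * (t ^ (N / τ - ((d : ℝ) - topMultiplicity A) / 2) * Real.exp (-(δ * t))) := by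
  have := hν.isProbabilityMeasure
  have hl1 : ∀ i, sigmaEigenvalues A i ≤ 1 := fun i => hA ▸ sigmaEigenvalues_le_top A i
  obtain ⟨C, hC, hL⟩ := exists_lintegral_exp_neg_le (sigmaEigenvalues A) hl1
    (κ := δ * τ / 4) (by positivity)
  rw [← topMultiplicity_eq hA, Fintype.card_fin] at hL
  set V := volume (Metric.ball (0 : EuclideanSpace ℝ (Fin d)) 1) with hV
  have : Nonempty (Fin d) := ⟨⟨0, by omega⟩⟩
  have hV0 : V ≠ 0 := (Metric.measure_ball_pos volume _ one_pos).ne'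
  have hVt : V ≠ ⊤ := measure_ball_lt_top.ne
  have hVr : 0 < V.toReal := ENNReal.toReal_pos hV0 hVt
  refine ⟨V.toReal⁻¹ * (2 * c * C), by positivity, ?_⟩
  filter_upwards [hν.eventually_scaled_tail_le hc hδ hτ, eventually_gt_atTop 0] with t ht ht0
  set e := -((d : ℝ) - topMultiplicity A) / 2 with he
  have hbound : ellipticalLaw A ν {x | t ^ (1 / τ) ≤ ‖x‖} ≤
      ENNReal.ofReal (V.toReal⁻¹ * (2 * c * (t ^ (N / τ) * Real.exp (-(δ * t))) * (C * t ^ e))) := by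
    rw [ellipticalLaw_norm_ge (by omega), ENNReal.ofReal_mul (by positivity),
      ENNReal.ofReal_inv_of_pos hVr, ENNReal.ofReal_toReal hVt]
    refine mul_le_mul_right ?_ _
    calc ∫⁻ y in Metric.ball (0 : EuclideanSpace ℝ (Fin d)) 1,
          ν {r | t ^ (1 / τ) ≤ |r| * (√(∑ i, sigmaEigenvalues A i * y i ^ 2) / ‖y‖)}
        ≤ ∫⁻ y in Metric.ball (0 : EuclideanSpace ℝ (Fin d)) 1,
          ENNReal.ofReal (2 * c * (t ^ (N / τ) * Real.exp (-(δ * t)))) *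
          ENNReal.ofReal (Real.exp (-(δ * τ / 4 * t *
            ∑ i, (1 - sigmaEigenvalues A i) * y i ^ 2))) := by
          refine setLIntegral_mono_ae' measurableSet_ball ?_
          have hne : ∀ᵐ y : EuclideanSpace ℝ (Fin d), y ≠ 0 := by
            rw [ae_iff]
            simp
          filter_upwards [hne] with y hy0 hy
          have hn : 0 < ‖y‖ := norm_pos_iff.2 hy0
          have hn1 : ‖y‖ ^ 2 ≤ 1 :=
            pow_le_one₀ (norm_nonneg _) (mem_ball_zero_iff.1 hy).le
          have hq0 : 0 ≤ ∑ i, (1 - sigmaEigenvalues A i) * y i ^ 2 :=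
            Finset.sum_nonneg fun i _ => mul_nonneg (sub_nonneg.2 (hl1 i)) (sq_nonneg _)
          -- The true deficit is the sum divided by `‖y‖ ^ 2`; since `‖y‖ < 1`, dropping the
          -- division only weakens the bound and leaves a product of functions of single
          -- coordinates.
          refine ht _ _ (by positivity) hq0 ?_
          have hs0 : 0 ≤ ∑ i, sigmaEigenvalues A i * y i ^ 2 :=
            Finset.sum_nonneg fun i _ => mul_nonneg (sigmaEigenvalues_nonneg A i) (sq_nonneg _)
          have h4 : ∑ i, (1 - sigmaEigenvalues A i) * y i ^ 2 =
              ‖y‖ ^ 2 - ∑ i, sigmaEigenvalues A i * y i ^ 2 := by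
            rw [EuclideanSpace.real_norm_sq_eq, ← Finset.sum_sub_distrib]
            exact Finset.sum_congr rfl fun i _ => by ring
          rw [div_pow, Real.sq_sqrt hs0, div_le_iff₀ (by positivity)]
          nlinarith [mul_le_mul_of_nonneg_left hn1 hq0]
      _ ≤ ENNReal.ofReal (2 * c * (t ^ (N / τ) * Real.exp (-(δ * t)))) *
          ENNReal.ofReal (C * t ^ e) := by
          rw [lintegral_const_mul' _ _ ENNReal.ofReal_ne_top]
          exact mul_le_mul_right (hL t ht0) _
      _ = _ := by rw [← ENNReal.ofReal_mul (by positivity)]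
  have h5 := ENNReal.toReal_le_of_le_ofReal (by positivity) hbound
  refine h5.trans_eq ?_
  have h6 : N / τ - ((d : ℝ) - topMultiplicity A) / 2 = N / τ + e := by rw [he]; ring
  rw [h6, Real.rpow_add ht0]
  ring

theorem exists_le_ellipticalLaw_tail {d : ℕ} (hd : 2 ≤ d) (A : Matrix (Fin d) (Fin d) ℝ)
    (hA : topEigenvalue A = 1) {c N δ τ : ℝ} (hc : 0 < c) (hτ : 0 < τ)
    {ν : Measure ℝ} (hν : IsKotzIIIRadius ν c N δ τ) :
    ∃ C : ℝ, 0 < C ∧ ∀ᶠ t : ℝ in atTop,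
        C * (t ^ (N / τ - ((d : ℝ) - topMultiplicity A) / 2) * Real.exp (-(δ * t))) ≤
      (ellipticalLaw A ν).real {x | t ^ (1 / τ) ≤ ‖x‖} := by
  have := hν.isProbabilityMeasure
  obtain ⟨i₀, hi₀⟩ := exists_sigmaEigenvalues_eq_top (by omega) A
  obtain ⟨C, hC, hL⟩ := exists_volume_near_top_ge (sigmaEigenvalues A) (sigmaEigenvalues_nonneg A)
    ⟨i₀, hi₀.trans hA⟩ (by simpa using hd) (ε := 1 / (τ + 1)) (by positivity)
    (by rw [div_le_one (by positivity)]; linarith)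
  rw [← topMultiplicity_eq hA, Fintype.card_fin] at hL
  obtain ⟨C', hC', hT⟩ := hν.exists_eventually_le_scaled_tail hc hτ
  set V := volume (Metric.ball (0 : EuclideanSpace ℝ (Fin d)) 1) with hV
  have : Nonempty (Fin d) := ⟨⟨0, by omega⟩⟩
  have hV0 : V ≠ 0 := (Metric.measure_ball_pos volume _ one_pos).ne'
  have hVt : V ≠ ⊤ := measure_ball_lt_top.ne
  have hVr : 0 < V.toReal := ENNReal.toReal_pos hV0 hVt
  have hfin : IsFiniteMeasure (ellipticalLaw A ν) := by
    unfold ellipticalLaw uniformSphere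
    infer_instance
  refine ⟨V.toReal⁻¹ * (C' * C), by positivity, ?_⟩
  filter_upwards [hT, eventually_ge_atTop 1] with t ht ht1
  have ht0 : 0 < t := by linarith
  obtain ⟨D, hDm, hDball, hD0, hDq, hDv⟩ := hL t ht1
  set e := -((d : ℝ) - topMultiplicity A) / 2 with he
  have hbound :
      ENNReal.ofReal (V.toReal⁻¹ * (C' * (t ^ (N / τ) * Real.exp (-(δ * t))) * (C * t ^ e))) ≤
      ellipticalLaw A ν {x | t ^ (1 / τ) ≤ ‖x‖} := by
    rw [ellipticalLaw_norm_ge (by omega), ENNReal.ofReal_mul (by positivity),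
      ENNReal.ofReal_inv_of_pos hVr, ENNReal.ofReal_toReal hVt]
    refine mul_le_mul_right ?_ _
    calc ENNReal.ofReal (C' * (t ^ (N / τ) * Real.exp (-(δ * t))) * (C * t ^ e))
        = ENNReal.ofReal (C' * (t ^ (N / τ) * Real.exp (-(δ * t)))) *
          ENNReal.ofReal (C * t ^ e) := by rw [← ENNReal.ofReal_mul (by positivity)]
      _ ≤ ENNReal.ofReal (C' * (t ^ (N / τ) * Real.exp (-(δ * t)))) * volume D :=
          mul_le_mul_right hDv _
      _ = ∫⁻ y in D, ENNReal.ofReal (C' * (t ^ (N / τ) * Real.exp (-(δ * t)))) :=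
          (setLIntegral_const _ _).symm
      -- On `D` the squared ratio is at least `1 - ε / t` with `ε = 1 / (τ + 1)`, the window in
      -- which the radial lower bound is uniform.
      _ ≤ ∫⁻ y in D,
          ν {r | t ^ (1 / τ) ≤ |r| * (√(∑ i, sigmaEigenvalues A i * y i ^ 2) / ‖y‖)} := by
          refine setLIntegral_mono' hDm fun y hy => ht _ (by positivity) ?_
          have hn : 0 < ‖y‖ := norm_pos_iff.2 (hD0 y hy)
          have hs0 : 0 ≤ ∑ i, sigmaEigenvalues A i * y i ^ 2 :=
            Finset.sum_nonneg fun i _ => mul_nonneg (sigmaEigenvalues_nonneg A i) (sq_nonneg _)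
          rw [div_pow, Real.sq_sqrt hs0, le_div_iff₀ (by positivity)]
          exact hDq y hy
      _ ≤ _ := lintegral_mono_set hDball
  have h5 := (ENNReal.ofReal_le_iff_le_toReal (measure_ne_top _ _)).1 hbound
  refine le_trans (le_of_eq ?_) h5
  have h6 : N / τ - ((d : ℝ) - topMultiplicity A) / 2 = N / τ + e := by rw [he]; ring
  rw [h6, Real.rpow_add ht0]
  ring

/-! ### The logarithmic series and the levels. -/

/-- Cauchy condensation turns the series into `∑ k ^ (-a)` up to a constant when `a ≥ 0`; for `a <
0` the terms eventually dominate the harmonic series. -/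
theorem summable_inv_mul_log_rpow_iff {a : ℝ} :
    Summable (fun n : ℕ => (n : ℝ)⁻¹ * Real.log n ^ (-a)) ↔ 1 < a := by
  rcases le_or_gt 0 a with ha | ha
  · have hmono : ∀ᶠ k : ℕ in atTop, ((k + 1 : ℕ) : ℝ)⁻¹ * Real.log ((k + 1 : ℕ) : ℝ) ^ (-a) ≤
        (k : ℝ)⁻¹ * Real.log k ^ (-a) := by
      filter_upwards [eventually_ge_atTop 2] with k hk
      have hk1 : (1 : ℝ) < k := by exact_mod_cast hk
      have hlog : 0 < Real.log k := Real.log_pos hk1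
      have hle : (k : ℝ) ≤ ((k + 1 : ℕ) : ℝ) := by push_cast; linarith
      have h1 : Real.log ((k + 1 : ℕ) : ℝ) ^ (-a) ≤ Real.log k ^ (-a) :=
        Real.rpow_le_rpow_of_nonpos hlog (Real.log_le_log (by linarith) hle) (by linarith)
      have h2 : 0 ≤ Real.log ((k + 1 : ℕ) : ℝ) ^ (-a) :=
        Real.rpow_nonneg (Real.log_natCast_nonneg _) _
      gcongr
    rw [← summable_condensed_iff_of_eventually_nonneg (Eventually.of_forall fun n =>
      mul_nonneg (by positivity) (Real.rpow_nonneg (Real.log_natCast_nonneg _) _)) hmono]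
    have h : (fun k : ℕ => (2 : ℝ) ^ k * ((((2 ^ k : ℕ) : ℝ))⁻¹ *
        Real.log ((2 ^ k : ℕ) : ℝ) ^ (-a))) =
        fun k : ℕ => (k : ℝ) ^ (-a) * Real.log 2 ^ (-a) := by
      ext k
      push_cast
      rw [← mul_assoc, mul_inv_cancel₀ (by positivity), one_mul, Real.log_pow,
        Real.mul_rpow (by positivity) (Real.log_nonneg (by norm_num))]
    rw [h, summable_mul_right_iff (Real.rpow_pos_of_pos (Real.log_pos (by norm_num)) _).ne',
      Real.summable_nat_rpow]
    exact neg_lt_neg_iff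
  · refine iff_of_false (fun h => Real.not_summable_natCast_inv ?_) (by linarith)
    refine summable_of_isBigO_nat h (IsBigO.of_bound' ?_)
    filter_upwards [(Real.tendsto_log_atTop.comp tendsto_natCast_atTop_atTop).eventually_ge_atTop 1]
      with n hn
    have hn' : 1 ≤ Real.log n := hn
    have h1 : 1 ≤ Real.log n ^ (-a) := Real.one_le_rpow hn' (by linarith)
    rw [norm_mul, Real.norm_of_nonneg (zero_le_one.trans h1)]
    exact le_mul_of_one_le_right (norm_nonneg _) h1

theorem tendsto_log_natCast_atTop : Tendsto (fun n : ℕ => Real.log n) atTop atTop :=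
  Real.tendsto_log_atTop.comp tendsto_natCast_atTop_atTop

theorem isEquivalent_mul_log_add (τ s : ℝ) :
    (fun n : ℕ => τ * (Real.log n + s * Real.log (Real.log n))) ~[atTop]
      (fun n : ℕ => τ * Real.log n) := by
  refine IsEquivalent.mul IsEquivalent.refl ?_
  refine IsEquivalent.add_isLittleO IsEquivalent.refl (IsLittleO.const_mul_left ?_ s)
  exact Real.isLittleO_log_id_atTop.comp_tendsto tendsto_log_natCast_atTop

theorem tendsto_mul_log_add_atTop {τ : ℝ} (hτ : 0 < τ) (s : ℝ) :
    Tendsto (fun n : ℕ => τ * (Real.log n + s * Real.log (Real.log n))) atTop atTop :=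
  (isEquivalent_mul_log_add τ s).symm.tendsto_atTop (tendsto_log_natCast_atTop.const_mul_atTop hτ)

theorem tendsto_bStar_atTop {τ : ℝ} (hτ : 0 < τ) (s : ℝ) : Tendsto (bStar τ s) atTop atTop :=
  (tendsto_rpow_atTop (one_div_pos.2 hτ)).comp (tendsto_mul_log_add_atTop hτ s)

/-- The derivative `1 + s / x` is nonnegative for `x ≥ |s|`; this makes the levels eventually
monotone even for negative `s`. -/
theorem add_mul_log_le_add_mul_log {s x y : ℝ} (hx : 0 < x) (hs : |s| ≤ x) (hxy : x ≤ y) :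
    x + s * Real.log x ≤ y + s * Real.log y := by
  have hy : 0 < y := hx.trans_le hxy
  have h1 : Real.log y - Real.log x ≤ (y - x) / x := by
    rw [← Real.log_div hy.ne' hx.ne', sub_div, div_self hx.ne']
    exact Real.log_le_sub_one_of_pos (by positivity)
  have h2 : 0 ≤ Real.log y - Real.log x := sub_nonneg.2 (Real.log_le_log hx hxy)
  have h3 : |s| * (Real.log y - Real.log x) ≤ y - x := by
    calc |s| * (Real.log y - Real.log x) ≤ x * ((y - x) / x) :=
          mul_le_mul hs h1 h2 hx.le
      _ = y - x := by field_simp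
  nlinarith [mul_le_mul_of_nonneg_right (neg_abs_le s) h2]

theorem eventually_bStar_le_bStar {τ : ℝ} (hτ : 0 < τ) (s : ℝ) :
    ∀ᶠ n : ℕ in atTop, ∀ k, n ≤ k → bStar τ s n ≤ bStar τ s k := by
  filter_upwards [eventually_gt_atTop 0, tendsto_log_natCast_atTop.eventually_gt_atTop 0,
    tendsto_log_natCast_atTop.eventually_ge_atTop |s|,
    (tendsto_mul_log_add_atTop hτ s).eventually_ge_atTop 0] with n hn0 hn hns htn k hk
  have hlog : Real.log n ≤ Real.log k :=
    Real.log_le_log (by exact_mod_cast hn0) (by exact_mod_cast hk)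
  exact Real.rpow_le_rpow htn
    (mul_le_mul_of_nonneg_left (add_mul_log_le_add_mul_log hn hns hlog) hτ.le) (by positivity)

/-! ### From the running maximum to single terms, and Borel–Cantelli. -/

theorem norm_le_maxNorm {E : Type*} [Norm E] (x : ℕ → E) {j n : ℕ} (hj : j < n) :
    ‖x j‖ ≤ maxNorm x n :=
  le_ciSup (f := fun i : Fin n => ‖x i‖) (Set.finite_range _).bddAbove ⟨j, hj⟩

theorem exists_norm_eq_maxNorm {E : Type*} [Norm E] (x : ℕ → E) {n : ℕ} (hn : 0 < n) :
    ∃ j < n, ‖x j‖ = maxNorm x n := by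
  have : Nonempty (Fin n) := ⟨⟨0, hn⟩⟩
  obtain ⟨i, hi⟩ := exists_eq_ciSup_of_finite (f := fun i : Fin n => ‖x i‖)
  exact ⟨i, i.2, hi⟩

/-- For a level sequence that eventually increases to infinity, the running maximum exceeds the
level infinitely often if and only if the individual terms do. -/
theorem frequently_le_maxNorm_iff {E : Type*} [Norm E] {b : ℕ → ℝ} (hb : Tendsto b atTop atTop)
    (hmono : ∀ᶠ n in atTop, ∀ k, n ≤ k → b n ≤ b k) (x : ℕ → E) :
    (∃ᶠ n in atTop, b n ≤ maxNorm x n) ↔ ∃ᶠ j in atTop, b (j + 1) ≤ ‖x j‖ := by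
  constructor
  · intro h
    by_contra hcon
    rw [not_frequently] at hcon
    obtain ⟨J, hJ⟩ := eventually_atTop.1
      (hcon.and ((tendsto_add_atTop_nat 1).eventually hmono))
    refine h ?_
    -- Once the level passes the maximum of the first `J` terms, a later index `j` must attain it.
    -- Indexing starts at 0, so term `j` enters at time `j + 1 ≤ n`, whence `b (j + 1) ≤ b n`.
    filter_upwards [eventually_gt_atTop 0, hb.eventually_gt_atTop (maxNorm x J)] with n hn hbn hle
    obtain ⟨j, hj, hxj⟩ := exists_norm_eq_maxNorm x hn
    rcases lt_or_ge j J with hjJ | hjJ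
    · have := norm_le_maxNorm x hjJ
      linarith
    · have h1 := not_le.1 (hJ j hjJ).1
      have h2 := (hJ j hjJ).2 n hj
      linarith
  · intro h
    have h' : ∃ᶠ j in atTop, b (j + 1) ≤ maxNorm x (j + 1) :=
      h.mono fun j hj => hj.trans (norm_le_maxNorm x (Nat.lt_succ_self j))
    exact (tendsto_add_atTop_nat 1).frequently h'

theorem ellipticalLaw_tail_bStar_isTheta {d : ℕ} (hd : 2 ≤ d) (A : Matrix (Fin d) (Fin d) ℝ)
    (hA : topEigenvalue A = 1) {c N δ τ : ℝ} (hc : 0 < c) (hδ : 0 < δ) (hτ : 0 < τ)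
    (hδτ : δ * τ = 1) {ν : Measure ℝ} (hν : IsKotzIIIRadius ν c N δ τ) (s : ℝ) :
    (fun n : ℕ => (ellipticalLaw A ν).real {x | bStar τ s n ≤ ‖x‖}) =Θ[atTop]
      (fun n : ℕ => (n : ℝ)⁻¹ *
        Real.log n ^ (-(s - (N / τ - ((d : ℝ) - topMultiplicity A) / 2)))) := by
  set p := N / τ - ((d : ℝ) - topMultiplicity A) / 2 with hp
  have hT : (fun t : ℝ => (ellipticalLaw A ν).real {x | t ^ (1 / τ) ≤ ‖x‖}) =Θ[atTop]
      (fun t : ℝ => t ^ p * Real.exp (-(δ * t))) := by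
    obtain ⟨C, hC, hle⟩ := exists_ellipticalLaw_tail_le hd A hA hc hδ hτ hν
    obtain ⟨C', hC', hge⟩ := exists_le_ellipticalLaw_tail hd A hA hc hτ hν
    constructor
    · refine IsBigO.of_bound C ?_
      filter_upwards [hle, eventually_gt_atTop 0] with t ht ht0
      rwa [Real.norm_of_nonneg measureReal_nonneg, Real.norm_of_nonneg (by positivity)]
    · refine IsBigO.of_bound C'⁻¹ ?_
      filter_upwards [hge, eventually_gt_atTop 0] with t ht ht0
      rwa [Real.norm_of_nonneg measureReal_nonneg, Real.norm_of_nonneg (by positivity),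
        ← div_eq_inv_mul, le_div_iff₀' hC']
  have htend := tendsto_mul_log_add_atTop hτ s
  have h1 : (fun n : ℕ => (ellipticalLaw A ν).real {x | bStar τ s n ≤ ‖x‖}) =Θ[atTop]
      (fun n : ℕ => (τ * (Real.log n + s * Real.log (Real.log n))) ^ p *
        Real.exp (-(δ * (τ * (Real.log n + s * Real.log (Real.log n)))))) :=
    ⟨hT.1.comp_tendsto htend, hT.2.comp_tendsto htend⟩
  have h2 : (fun n : ℕ => (τ * (Real.log n + s * Real.log (Real.log n))) ^ p) =Θ[atTop]
      (fun n : ℕ => Real.log n ^ p) := by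
    refine IsTheta.rpow (htend.eventually_ge_atTop 0)
      (tendsto_log_natCast_atTop.eventually_ge_atTop 0) ?_
    exact (isEquivalent_mul_log_add τ s).isTheta.trans
      ((isTheta_refl _ _).const_mul_left hτ.ne')
  refine h1.trans ((h2.mul (isTheta_refl _ _)).trans (EventuallyEq.isTheta ?_))
  filter_upwards [eventually_gt_atTop 0, tendsto_log_natCast_atTop.eventually_gt_atTop 0]
    with n hn hlog
  have hn' : (0 : ℝ) < n := by exact_mod_cast hn
  have hexp : Real.exp (-(s * Real.log (Real.log n))) = Real.log n ^ (-s) := by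
    rw [Real.rpow_def_of_pos hlog]
    ring_nf
  -- Here `δ * τ = 1` makes the exponential exactly `n⁻¹ (ln n)^(-s)`.
  rw [← mul_assoc δ, hδτ, one_mul, neg_add, Real.exp_add, Real.exp_neg, Real.exp_log hn', hexp,
    show -(s - p) = p + -s by ring, Real.rpow_add hlog]
  ring

/-- Borel–Cantelli for identically distributed independent vectors and a sequence of levels. -/
theorem measure_frequently_le_norm {E : Type*} [NormedAddCommGroup E] [MeasurableSpace E]
    [BorelSpace E] {μ : Measure E} {Ω : Type*} [MeasurableSpace Ω] {P : Measure Ω}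
    [IsProbabilityMeasure P] {X : ℕ → Ω → E} (hX : ∀ j, HasLaw (X j) μ P) (b : ℕ → ℝ) :
    (Summable (fun j => μ.real {x | b j ≤ ‖x‖}) → P {ω | ∃ᶠ j in atTop, b j ≤ ‖X j ω‖} = 0) ∧
    (iIndepFun X P → ¬ Summable (fun j => μ.real {x | b j ≤ ‖x‖}) →
      P {ω | ∃ᶠ j in atTop, b j ≤ ‖X j ω‖} = 1) := by
  have hμ : IsProbabilityMeasure μ := (hX 0).isProbabilityMeasure_iff.1 inferInstance
  have hm : ∀ j, MeasurableSet {x : E | b j ≤ ‖x‖} := fun j =>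
    measurableSet_le measurable_const measurable_norm
  -- `HasLaw` gives only a.e. measurability; measurable versions provide the measurable events used
  -- for independence and change the limsup event by a null set.
  let Y : ℕ → Ω → E := fun j => (hX j).aemeasurable.mk (X j)
  have hY : ∀ j, Measurable (Y j) := fun j => (hX j).aemeasurable.measurable_mk
  have hXY : ∀ j, X j =ᵐ[P] Y j := fun j => (hX j).aemeasurable.ae_eq_mk
  have hPY : ∀ j, P (Y j ⁻¹' {x | b j ≤ ‖x‖}) = μ {x | b j ≤ ‖x‖} := by
    intro j
    rw [← Measure.map_apply (hY j) (hm j), ← Measure.map_congr (hXY j), (hX j).map_eq]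
  have hlim : P {ω | ∃ᶠ j in atTop, b j ≤ ‖X j ω‖} =
      P (limsup (fun j => Y j ⁻¹' {x | b j ≤ ‖x‖}) atTop) := by
    refine measure_congr ?_
    filter_upwards [ae_all_iff.2 hXY] with ω hω
    refine propext ?_
    change (∃ᶠ j in atTop, b j ≤ ‖X j ω‖) ↔ ω ∈ limsup (fun j => Y j ⁻¹' {x | b j ≤ ‖x‖}) atTop
    rw [mem_limsup_iff_frequently_mem]
    simp only [hω]
    rfl
  rw [hlim]
  refine ⟨fun hs => measure_limsup_atTop_eq_zero ?_, fun hind hs => measure_limsup_eq_one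
    (fun j => hY j (hm j)) ?_ ?_⟩
  · exact ne_of_eq_of_ne (tsum_congr fun j => (hPY j).trans (ofReal_measureReal (measure_ne_top _ _)).symm)
      hs.tsum_ofReal_ne_top
  · have hindY : iIndepFun Y P := hind.congr hXY
    rw [iIndepSet_iff_meas_biInter fun j => hY j (hm j)]
    exact fun S => hindY.meas_biInter fun j _ => ⟨_, hm j, rfl⟩
  · by_contra htop
    refine hs ?_
    exact (summable_congr fun j => by rw [measureReal_def, hPY]).1 (ENNReal.summable_toReal htop)

theorem theorem2 {d : ℕ} (hd : 2 ≤ d) (A : Matrix (Fin d) (Fin d) ℝ)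
    (hA : topEigenvalue A = 1)
    {c δ τ : ℝ} (hc : 0 < c) (hδ : 0 < δ) (hτ : 0 < τ) (N : ℝ) (hδτ : δ * τ = 1)
    (ν : Measure ℝ) (hν : IsKotzIIIRadius ν c N δ τ)
    {Ω : Type*} [MeasurableSpace Ω] (P : Measure Ω) [IsProbabilityMeasure P]
    (X : ℕ → Ω → EuclideanSpace ℝ (Fin d))
    (hX : ∀ j, HasLaw (X j) (ellipticalLaw A ν) P)
    (hindep : iIndepFun X P) (s : ℝ) :
    (s ≤ N / τ - ((d : ℝ) - (topMultiplicity A : ℝ)) / 2 + 1 →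
      P {ω | ∃ᶠ n : ℕ in atTop, bStar τ s n ≤ maxNorm (fun j => X j ω) n} = 1) ∧
    (N / τ - ((d : ℝ) - (topMultiplicity A : ℝ)) / 2 + 1 < s →
      P {ω | ∃ᶠ n : ℕ in atTop, bStar τ s n ≤ maxNorm (fun j => X j ω) n} = 0) := by
  -- The strict inequality puts the critical value of `s` on the divergent side, hence in the
  -- probability-one case.
  have hsum : Summable (fun j : ℕ => (ellipticalLaw A ν).real {x | bStar τ s (j + 1) ≤ ‖x‖}) ↔
      1 < s - (N / τ - ((d : ℝ) - (topMultiplicity A : ℝ)) / 2) := by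
    rw [summable_nat_add_iff (f := fun n : ℕ => (ellipticalLaw A ν).real {x | bStar τ s n ≤ ‖x‖}) 1,
      (ellipticalLaw_tail_bStar_isTheta hd A hA hc hδ hτ hδτ hν s).summable_iff_nat,
      summable_inv_mul_log_rpow_iff]
  simp_rw [frequently_le_maxNorm_iff (tendsto_bStar_atTop hτ s) (eventually_bStar_le_bStar hτ s)]
  obtain ⟨h0, h1⟩ := measure_frequently_le_norm hX fun j => bStar τ s (j + 1)
  exact ⟨fun hs => h1 hindep fun h => by linarith [hsum.1 h],
    fun hs => h0 (hsum.2 (by linarith))⟩
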